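/- Let $n\ge 1$. Consider $n$ buyers with values $v_1,\dots,v_n\ge 0$ drawn independently from a distribution $F$, and a seller whose cost $c\ge 0$ is drawn from a distribution $G$ independently of the values. A real random variable with CDF $H$ and PDF $h$ is called MHR (monotone hazard rate) if $h/(1-H)$ is non-decreasing on $\{H<1\}$; its virtual value is $\phi(x)=x-\frac{1-H(x)}{h(x)}$ (read as $-\infty$ where $h(x)=0$), and its monopoly price is $\eta=\phi^{-1}(0)$, where in the absence of a zero $\phi^{-1}(0)$ means $\inf\{x: H(x)<1,\ \phi(x)\ge 0\}$ (and $\eta=0$ if this set is empty, that is, if the variable is almost surely $\le 0$). In the fee-setting mechanism with fee schedule $w$, the seller names a price $P$, which is posted to the buyers; if $\max_i v_i\ge P$, the item is sold for $P$ to a buyer with value at least $P$, the intermediary keeps $w(P)$ and the seller receives $P-w(P)$; otherwise there is no trade and no payment. A (measurable) map $c\mapsto P(c)$ is a Bayes–Nash equilibrium (BNE) strategy of the seller if for every $c$ in the support of $G$ the price $P(c)$ maximizes $(p-w(p)-c)\Pr\{\max_i v_i\ge p\}$ over $p\in\mathbb{R}$. The revenue of the mechanism is $\mathrm{APX}=\mathbb{E}\big[w(P(c))\,\mathbf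 1\{\max_i v_i\ge P(c)\}\big]$. The optimal surplus is $\mathrm{OPT\text{-}Surplus}=\mathbb{E}\big[(\max_i v_i-c)_+\big]$. The optimal revenue $\mathrm{OPT\text{-}Rev}$ is the supremum of the intermediary's expected revenue (buyers' payments minus payment to the seller) over all direct mechanisms for the $n$ buyers and the seller that are Bayesian incentive compatible and interim individually rational (with finite expected payments). Suppose that $F$ is MHR and that the distribution of $\max_i v_i-c$ is MHR, and let $\eta$ be the monopoly price of $\max_i v_i-c$. Then for the constant fee schedule $w(P)=\eta$ the seller has a BNE strategy, and for every BNE strategy of the seller $$\mathrm{OPT\text{-}Surplus}\le e^2\cdot \mathrm{APX}\qquad\text{and}\qquad \mathrm{OPT\text{-}Rev}\le e^2\cdot\mathrm{APX}.$$ -/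

import Mathlib

open MeasureTheory ProbabilityTheory

noncomputable section

namespace Exchange

/-! ### Distributions: densities, hazard rates, virtual values, monopoly prices -/

/-- `f` is a probability density function (PDF) of the law `ν` on the real line. -/
structure IsDensity (ν : Measure ℝ) (f : ℝ → ℝ) : Prop where
  measurable : Measurable f
  nonneg : ∀ x, 0 ≤ f x
  eq_withDensity : ν = volume.withDensity (fun x => ENNReal.ofReal (f x))

/-- The hazard rate `f(x) / (1 - F(x))`; it is meaningful where `F(x) < 1`. -/
def hazardRate (ν : Measure ℝ) (f : ℝ → ℝ) (x : ℝ) : ℝ := f x / (1 - cdf ν x)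

/-- The law `ν` with PDF `f` has a monotone hazard rate: `f / (1 - F)` is non-decreasing on
`{F < 1}`. -/
structure IsMHR (ν : Measure ℝ) (f : ℝ → ℝ) : Prop where
  density : IsDensity ν f
  monotone : MonotoneOn (hazardRate ν f) {x | cdf ν x < 1}

/-- The virtual value `φ(x) = x - (1 - F(x)) / f(x)`; it is meaningful where `f(x) > 0`. -/
def virtualValue (ν : Measure ℝ) (f : ℝ → ℝ) (x : ℝ) : ℝ := x - (1 - cdf ν x) / f x

/-- The monopoly price `φ⁻¹(0)`, as a generalized inverse: the least price from which on the
virtual value is non-negative. Points with `F < 1` and `f = 0` have virtual value `-∞`, hence do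
not count. If `φ` vanishes somewhere, this is the zero of `φ`
(see `monopolyPrice_eq_of_virtualValue_eq_zero`). -/
def monopolyPrice (ν : Measure ℝ) (f : ℝ → ℝ) : ℝ :=
  sInf {x | 0 < f x ∧ cdf ν x < 1 ∧ 0 ≤ virtualValue ν f x}

theorem monopolyPrice_eq_of_virtualValue_eq_zero {ν : Measure ℝ} {f : ℝ → ℝ} (h : IsMHR ν f)
    {x : ℝ} (hfx : 0 < f x) (hx : cdf ν x < 1) (h0 : virtualValue ν f x = 0) :
    monopolyPrice ν f = x := by
  refine IsLeast.csInf_eq ⟨⟨hfx, hx, h0.ge⟩, ?_⟩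
  rintro y ⟨hfy, hy, h1⟩
  by_contra! hyx
  have hm : hazardRate ν f y ≤ hazardRate ν f x := h.monotone hy hx hyx.le
  have hpos : 0 < hazardRate ν f y := div_pos hfy (by linarith)
  have hinv := inv_anti₀ hpos hm
  unfold hazardRate at hinv
  rw [inv_div, inv_div] at hinv
  unfold virtualValue at h0 h1
  linarith

/-! ### The market: `n` i.i.d. buyers with values from `F`, a seller with cost from `G` -/

/-- The joint law of the value profile `(v₁, …, vₙ)` and the cost `c`: all are independent,
`vᵢ ∼ F` and `c ∼ G`. -/
def jointLaw (n : ℕ) (F G : Measure ℝ) : Measure ((Fin n → ℝ) × ℝ) :=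
  (Measure.pi fun _ : Fin n => F).prod G

/-- The law of `maxᵢ vᵢ - c`. -/
def maxDiffLaw (n : ℕ) (F G : Measure ℝ) : Measure ℝ :=
  (jointLaw n F G).map fun z => (⨆ i, z.1 i) - z.2

/-- The optimal (VCG) surplus `E[(maxᵢ vᵢ - c)₊]`. -/
def optSurplus (n : ℕ) (F G : Measure ℝ) : ENNReal :=
  ∫⁻ z, ENNReal.ofReal ((⨆ i, z.1 i) - z.2) ∂jointLaw n F G

/-! ### Fee-setting mechanisms

The seller names a price `p`, which is posted to the buyers. If some buyer has value at least `p`,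
the item is sold to such a buyer for `p`; the intermediary keeps `w p` and pays `p - w p` to the
seller. Otherwise nothing is traded or paid. -/

/-- Expected utility of a seller with cost `c` who names the price `p`. -/
def sellerUtility (n : ℕ) (F : Measure ℝ) (w : ℝ → ℝ) (c p : ℝ) : ℝ :=
  open Classical in
  ∫ v, (if ∃ i, p ≤ v i then p - w p - c else 0) ∂(Measure.pi fun _ : Fin n => F)

/-- `P` is a Bayes-Nash equilibrium strategy of the seller (buyers accept exactly the prices that
do not exceed their values): for every cost type `c`, the price `P c` is a best response. -/
structure IsSellerBNE (n : ℕ) (F G : Measure ℝ) (w P : ℝ → ℝ) : Prop where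
  measurable : Measurable P
  best_response : ∀ c ∈ G.support, ∀ p, sellerUtility n F w c p ≤ sellerUtility n F w c (P c)

/-- Expected revenue of the intermediary when the seller plays the strategy `P`. -/
def feeRevenue (n : ℕ) (F G : Measure ℝ) (w P : ℝ → ℝ) : ℝ :=
  open Classical in
  ∫ z, (if ∃ i, P z.2 ≤ z.1 i then w (P z.2) else 0) ∂jointLaw n F G

/-! ### Direct exchange mechanisms and the optimal revenue -/

/-- A direct revelation exchange mechanism for `n` buyers and one seller. On a profile `v` of
reported values and a reported cost `c`, buyer `i` gets the item with probability `alloc i v c` and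
pays `buyerPay i v c`, the seller gives the item away with probability `∑ i, alloc i v c` and
receives `sellerPay v c`. -/
structure DirectMechanism (n : ℕ) where
  alloc : Fin n → (Fin n → ℝ) → ℝ → ℝ
  buyerPay : Fin n → (Fin n → ℝ) → ℝ → ℝ
  sellerPay : (Fin n → ℝ) → ℝ → ℝ
  measurable_alloc : ∀ i, Measurable (Function.uncurry (alloc i))
  measurable_buyerPay : ∀ i, Measurable (Function.uncurry (buyerPay i))
  measurable_sellerPay : Measurable (Function.uncurry sellerPay)
  alloc_nonneg : ∀ i v c, 0 ≤ alloc i v c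
  sum_alloc_le_one : ∀ v c, ∑ i, alloc i v c ≤ 1

namespace DirectMechanism

variable {n : ℕ}

/-- Interim expected utility of buyer `i` with value `t` who reports `r`, all others being
truthful. -/
def buyerUtility (M : DirectMechanism n) (F G : Measure ℝ) (i : Fin n) (t r : ℝ) : ℝ :=
  ∫ z, (t * M.alloc i (Function.update z.1 i r) z.2
    - M.buyerPay i (Function.update z.1 i r) z.2) ∂jointLaw n F G

/-- Interim expected utility of the seller with cost `c` who reports `r`, all buyers being
truthful. -/
def sellerUtility (M : DirectMechanism n) (F : Measure ℝ) (c r : ℝ) : ℝ :=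
  ∫ v, (M.sellerPay v r - c * ∑ i, M.alloc i v r) ∂(Measure.pi fun _ : Fin n => F)

/-- All (ex-ante and interim) expected payments are well defined and finite. -/
structure FinitePayments (M : DirectMechanism n) (F G : Measure ℝ) : Prop where
  buyer : ∀ i, Integrable (fun z => M.buyerPay i z.1 z.2) (jointLaw n F G)
  seller : Integrable (fun z => M.sellerPay z.1 z.2) (jointLaw n F G)
  buyer_interim : ∀ i, ∀ r ∈ F.support,
    Integrable (fun z => M.buyerPay i (Function.update z.1 i r) z.2) (jointLaw n F G)
  seller_interim : ∀ r ∈ G.support,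
    Integrable (fun v => M.sellerPay v r) (Measure.pi fun _ : Fin n => F)

/-- Bayesian incentive compatibility: truthful reporting is a Bayes-Nash equilibrium. -/
structure IsBIC (M : DirectMechanism n) (F G : Measure ℝ) : Prop where
  buyer : ∀ i, ∀ t ∈ F.support, ∀ r ∈ F.support,
    M.buyerUtility F G i t r ≤ M.buyerUtility F G i t t
  seller : ∀ c ∈ G.support, ∀ r ∈ G.support, M.sellerUtility F c r ≤ M.sellerUtility F c c

/-- Interim individual rationality. -/
structure IsInterimIR (M : DirectMechanism n) (F G : Measure ℝ) : Prop where
  buyer : ∀ i, ∀ t ∈ F.support, 0 ≤ M.buyerUtility F G i t t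
  seller : ∀ c ∈ G.support, 0 ≤ M.sellerUtility F c c

/-- Expected revenue of the intermediary under truthful reporting. -/
def revenue (M : DirectMechanism n) (F G : Measure ℝ) : ℝ :=
  ∫ z, ((∑ i, M.buyerPay i z.1 z.2) - M.sellerPay z.1 z.2) ∂jointLaw n F G

end DirectMechanism

/-- The optimal revenue: the supremum of the expected revenue over all BIC and interim IR
mechanisms. (The mechanism that never trades has revenue `0`, so truncating negative revenues at
`0` does not change the supremum.) -/
def optRevenue (n : ℕ) (F G : Measure ℝ) : ENNReal :=
  ⨆ (M : DirectMechanism n) (_ : M.FinitePayments F G) (_ : M.IsBIC F G)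
    (_ : M.IsInterimIR F G), ENNReal.ofReal (M.revenue F G)

end Exchange

end

noncomputable section

namespace Exchange

open Filter Topology Set

/-! Put `D = max v - c`, `r` its monopoly price. The bound `e ^ 2` is a product of two factors `e`,
both coming from the convexity of `-log` of an MHR tail. First factor (`IsMHR.lintegral_ofReal_le`):
the hazard rate of `D` crosses `1 / x` at `r`, so `1 / r` is a subgradient of the cumulative hazard
there and `Pr{D > x} ≤ Pr{D > r} * exp (1 - x / r)`. Integrating over `x > 0` gives `E[D₊] ≤ e * r *
Pr{D ≥ r}`. Second factor (`mul_exp_neg_one_le_of_optimal_price`): under the constant fee `r`, a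
seller of cost `c` is a monopolist with total cost `d = c + r` facing `max v`, whose tail `S` is MHR
because `F` is (`IsMonotoneHazardTail.max`). Optimality of `p` keeps the hazard rate below `1 / (p -
d)` on `(d, p)`, so `S p ≥ S d / e`. Averaging over `c`, trade has probability at least `Pr{D ≥ r} /
e`, and each trade pays `r`. Finally, individual rationality caps the buyers' payments by their
values and bounds the seller's receipts below by the cost, so revenue is at most surplus
(`optRevenue_le_optSurplus`). -/

/-! ### Tails with a monotone hazard rate -/

/-- `S` is the tail function of a continuous law on the real line and `h` is its hazard rate, which
is monotone. The hazard rate enters only through the two bounds on the increments of `S`. -/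
structure IsMonotoneHazardTail (S h : ℝ → ℝ) : Prop where
  antitone : Antitone S
  continuous : Continuous S
  nonneg : ∀ x, 0 ≤ S x
  le_one : ∀ x, S x ≤ 1
  tendsto_zero : Tendsto S atTop (𝓝 0)
  hazard_nonneg : ∀ x, 0 < S x → 0 ≤ h x
  hazard_mono : MonotoneOn h {x | 0 < S x}
  le_sub : ∀ a b, a ≤ b → 0 < S b → h a * S b * (b - a) ≤ S a - S b
  sub_le : ∀ a b, a ≤ b → 0 < S b → S a - S b ≤ h b * S a * (b - a)

/-- A one-step growth bound on all subintervals implies an exponential growth bound. -/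
theorem mul_exp_le_of_mul_one_add_le {T : ℝ → ℝ} {a b l : ℝ} (hab : a ≤ b)
    (h : ∀ x y, a ≤ x → x ≤ y → y ≤ b → T y * (1 + l * (y - x)) ≤ T x) :
    T b * Real.exp (l * (b - a)) ≤ T a := by
  have hlim : Tendsto (fun m : ℕ => T b * (1 + l * (b - a) / m) ^ m) atTop
      (𝓝 (T b * Real.exp (l * (b - a)))) :=
    (Real.tendsto_one_add_div_pow_exp _).const_mul _
  -- The rate `l` may be negative, so the step factor is positive only for fine partitions into `m`
  -- equal pieces.
  have hpos : ∀ᶠ m : ℕ in atTop, 0 < 1 + l * (b - a) / m := by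
    have h1 : Tendsto (fun m : ℕ => 1 + l * (b - a) / (m : ℝ)) atTop (𝓝 (1 + 0)) :=
      (tendsto_const_div_atTop_nhds_zero_nat _).const_add _
    rw [add_zero] at h1
    exact h1.eventually (lt_mem_nhds one_pos)
  refine le_of_tendsto hlim ?_
  filter_upwards [hpos, eventually_gt_atTop 0] with m hm hm0
  have hm0' : (0 : ℝ) < m := by exact_mod_cast hm0
  have hd : 0 ≤ (b - a) / m := div_nonneg (by linarith) hm0'.le
  have hend : a + m * ((b - a) / m) = b := by field_simp; ring
  have key : ∀ j : ℕ, j ≤ m →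
      T (a + j * ((b - a) / m)) * (1 + l * (b - a) / m) ^ j ≤ T a := by
    intro j
    induction j with
    | zero => intro _; simp
    | succ j ih =>
      intro hj
      have hj' : ((j : ℝ) + 1) ≤ m := by exact_mod_cast hj
      have hstep := h (a + j * ((b - a) / m)) (a + (j + 1) * ((b - a) / m))
        (by have := mul_nonneg (Nat.cast_nonneg (α := ℝ) j) hd; linarith) (by linarith)
        (by have := mul_le_mul_of_nonneg_right hj' hd; linarith)
      have e : 1 + l * (a + (j + 1) * ((b - a) / m) - (a + j * ((b - a) / m)))
          = 1 + l * (b - a) / m := by ring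
      rw [e] at hstep
      have := mul_le_mul_of_nonneg_right hstep (pow_nonneg hm.le j)
      push_cast
      calc T (a + (j + 1) * ((b - a) / m)) * (1 + l * (b - a) / m) ^ (j + 1)
          = T (a + (j + 1) * ((b - a) / m)) * (1 + l * (b - a) / m)
              * (1 + l * (b - a) / m) ^ j := by ring
        _ ≤ _ := this.trans (ih (by omega))
  have := key m le_rfl
  rwa [hend] at this

namespace IsMonotoneHazardTail

variable {S h : ℝ → ℝ}

theorem le_mul_exp_of_le_hazard_left (H : IsMonotoneHazardTail S h) {a b l : ℝ} (hab : a ≤ b)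
    (hl : 0 < S a → l ≤ h a) : S b ≤ S a * Real.exp (-(l * (b - a))) := by
  rcases (H.nonneg b).eq_or_lt with h0 | hb
  · rw [← h0]; exact mul_nonneg (H.nonneg a) (Real.exp_pos _).le
  have hpos : ∀ {x}, x ≤ b → 0 < S x := fun hx => hb.trans_le (H.antitone hx)
  have key : S b * Real.exp (l * (b - a)) ≤ S a := by
    refine mul_exp_le_of_mul_one_add_le hab fun x y hax hxy hyb => ?_
    have h1 := H.le_sub x y hxy (hpos hyb)
    have h2 : l ≤ h x :=
      (hl (hpos hab)).trans (H.hazard_mono (hpos hab) (hpos (hxy.trans hyb)) hax)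
    have h3 := mul_le_mul_of_nonneg_right (mul_le_mul_of_nonneg_right h2 (hpos hyb).le)
      (sub_nonneg.2 hxy)
    linarith
  rw [Real.exp_neg, ← div_eq_mul_inv, le_div_iff₀ (Real.exp_pos _)]
  exact key

/-- The hazard rate may jump at `a`, as it can at a monopoly price. Continuity of `S` makes its
value there irrelevant. -/
theorem le_mul_exp_of_le_hazard (H : IsMonotoneHazardTail S h) {a b l : ℝ} (hab : a < b)
    (hl : ∀ x, a < x → 0 < S x → l ≤ h x) : S b ≤ S a * Real.exp (-(l * (b - a))) := by
  have hc : ContinuousAt (fun x => S x * Real.exp (-(l * (b - x)))) a := by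
    have := H.continuous
    fun_prop
  refine ge_of_tendsto (hc.tendsto.mono_left nhdsWithin_le_nhds : Tendsto _ (𝓝[>] a) _) ?_
  filter_upwards [Ioo_mem_nhdsGT hab] with x hx
  exact H.le_mul_exp_of_le_hazard_left hx.2.le (hl x hx.1)

theorem mul_exp_le_of_hazard_right_le (H : IsMonotoneHazardTail S h) {a b l : ℝ} (hab : a ≤ b)
    (hb : 0 < S b) (hl : h b ≤ l) : S a * Real.exp (-(l * (b - a))) ≤ S b := by
  have hpos : ∀ {x}, x ≤ b → 0 < S x := fun hx => hb.trans_le (H.antitone hx)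
  -- Reflection turns the upper bound on increments of `S` into a one-step growth bound with rate
  -- `-l`.
  have key := mul_exp_le_of_mul_one_add_le (T := fun x => S (-x)) (a := -b) (b := -a) (l := -l)
    (by linarith) fun x y hbx hxy hya => by
      have h1 := H.sub_le (-y) (-x) (by linarith) (hpos (by linarith))
      have h2 : h (-x) ≤ l :=
        (H.hazard_mono (hpos (by linarith)) (hpos le_rfl) (by linarith)).trans hl
      have h3 := mul_le_mul_of_nonneg_right
        (mul_le_mul_of_nonneg_right h2 (hpos (x := -y) (by linarith)).le) (sub_nonneg.2 hxy)
      linarith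
  simp only [neg_neg] at key
  rwa [show -l * (-a - -b) = -(l * (b - a)) by ring] at key

theorem mul_exp_le_of_hazard_le (H : IsMonotoneHazardTail S h) {a b l : ℝ} (hab : a < b)
    (hl : ∀ x, a < x → x < b → 0 < S x ∧ h x ≤ l) : S a * Real.exp (-(l * (b - a))) ≤ S b := by
  have hc : ContinuousAt (fun x => S a * Real.exp (-(l * (x - a)))) b := by fun_prop
  refine le_of_tendsto_of_tendsto (hc.tendsto.mono_left nhdsWithin_le_nhds : Tendsto _ (𝓝[<] b) _)
    ((H.continuous.tendsto b).mono_left nhdsWithin_le_nhds) ?_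
  filter_upwards [Ioo_mem_nhdsLT hab] with x hx
  exact H.mul_exp_le_of_hazard_right_le hx.1.le (hl x hx.1 hx.2).1 (hl x hx.1 hx.2).2

/-- The tail is bounded by the exponential tail that touches it at `r`, if `1 / r` is a
subgradient of the cumulative hazard there. -/
theorem le_mul_exp_of_subgradient (H : IsMonotoneHazardTail S h) {r : ℝ} (hr : 0 < r)
    (hSr : 0 < S r) (hright : ∀ x, r < x → 0 < S x → 1 / r ≤ h x)
    (hleft : ∀ x, x < r → h x ≤ 1 / r) (x : ℝ) : S x ≤ S r * Real.exp (1 - x / r) := by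
  rcases lt_trichotomy x r with hx | rfl | hx
  · have := H.mul_exp_le_of_hazard_le hx fun y _ hyr =>
      ⟨hSr.trans_le (H.antitone hyr.le), hleft y hyr⟩
    rw [Real.exp_neg, ← div_eq_mul_inv, div_le_iff₀ (Real.exp_pos _)] at this
    rwa [show 1 - x / r = 1 / r * (r - x) by field_simp]
  · simp [div_self hr.ne']
  · rw [show 1 - x / r = -(1 / r * (x - r)) by field_simp; ring]
    exact H.le_mul_exp_of_le_hazard hx hright

theorem exists_gt_eq (H : IsMonotoneHazardTail S h) {a s : ℝ} (hs : 0 < s) (hsa : s < S a) :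
    ∃ b, a < b ∧ S b = s := by
  obtain ⟨c, hc, hac⟩ :=
    ((H.tendsto_zero.eventually (gt_mem_nhds hs)).and (eventually_ge_atTop a)).exists
  obtain ⟨b, hb, hbs⟩ := intermediate_value_Icc' hac H.continuous.continuousOn ⟨hc.le, hsa.le⟩
  refine ⟨b, hb.1.lt_of_ne ?_, hbs⟩
  rintro rfl
  exact hsa.ne' hbs

/-- If the virtual value is nowhere non-negative, then the law is concentrated on the non-positive
half-line. -/
theorem eq_zero_of_hazard_le_inv (H : IsMonotoneHazardTail S h)
    (hle : ∀ x, 0 < x → 0 < S x → h x ≤ 1 / x) : S 0 = 0 := by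
  by_contra hne
  have h0 : 0 < S 0 := (H.nonneg 0).lt_of_ne' hne
  have he : Real.exp (-1) < 1 := Real.exp_lt_one_iff.2 (by norm_num)
  have hp : 0 < S 0 * Real.exp (-1) := mul_pos h0 (Real.exp_pos _)
  -- A hazard rate at most `1 / b` on `(0, b]` would leave `S b ≥ S 0 / e`; this `b` has half of
  -- that.
  obtain ⟨b, hb, hSb⟩ := H.exists_gt_eq (a := 0) (s := S 0 * Real.exp (-1) / 2) (by positivity)
    (by nlinarith)
  have hSb0 : 0 < S b := by rw [hSb]; positivity
  have := H.mul_exp_le_of_hazard_right_le hb.le hSb0 (hle b hb hSb0)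
  rw [sub_zero, one_div, inv_mul_cancel₀ hb.ne', hSb] at this
  linarith

/-- A tail that falls to half its value has positive hazard at the point `b` where it does so, and
the hazard rate never drops afterwards. Left of `b` the constant makes the bound at least `1`. -/
theorem exists_le_mul_exp (H : IsMonotoneHazardTail S h) :
    ∃ C l : ℝ, 0 < l ∧ ∀ x, S x ≤ C * Real.exp (-(l * x)) := by
  by_cases hex : ∃ a, 0 < S a
  swap
  · refine ⟨1, 1, one_pos, fun x => ?_⟩
    push Not at hex
    exact (hex x).trans (by positivity)
  obtain ⟨a, ha⟩ := hex
  obtain ⟨b, hab, hSb⟩ := H.exists_gt_eq (half_pos ha) (half_lt_self ha)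
  have hb : 0 < S b := by rw [hSb]; positivity
  have hh : 0 < h b := by
    by_contra! hcon
    have h1 := H.sub_le a b hab.le hb
    have h2 := mul_nonpos_of_nonpos_of_nonneg (mul_nonpos_of_nonpos_of_nonneg hcon ha.le)
      (sub_nonneg.2 hab.le)
    linarith
  refine ⟨Real.exp (h b * b), h b, hh, fun x => ?_⟩
  rw [← Real.exp_add]
  rcases le_total b x with hx | hx
  · refine (H.le_mul_exp_of_le_hazard_left hx fun _ => le_rfl).trans ?_
    refine (mul_le_of_le_one_left (Real.exp_pos _).le (H.le_one b)).trans (le_of_eq ?_)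
    congr 1
    ring
  · refine (H.le_one x).trans (Real.one_le_exp ?_)
    have := mul_le_mul_of_nonneg_left hx hh.le
    linarith

/-- A seller with total cost `d` has an optimal price. -/
theorem exists_optimal_price (H : IsMonotoneHazardTail S h) (d : ℝ) :
    ∃ p, ∀ q, (q - d) * S q ≤ (p - d) * S p := by
  rcases (H.nonneg d).eq_or_lt with h0 | hd
  · refine ⟨d, fun q => ?_⟩
    rw [sub_self, zero_mul]
    rcases le_total q d with hq | hq
    · exact mul_nonpos_of_nonpos_of_nonneg (by linarith) (H.nonneg q)
    · rw [le_antisymm ((H.antitone hq).trans h0.ge) (H.nonneg q), mul_zero]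
  obtain ⟨r, hdr, hSr⟩ := H.exists_gt_eq (half_pos hd) (half_lt_self hd)
  have hr : 0 < (r - d) * S r := mul_pos (by linarith) (by rw [hSr]; positivity)
  have hc : Continuous fun q => (q - d) * S q := by
    have := H.continuous
    fun_prop
  -- The price `r` earns a positive profit, while profit is non-positive below `d` and tends to `0`
  -- at most by the exponential decay of `S`; so a maximum is attained.
  refine hc.exists_forall_ge' r ?_
  rw [cocompact_eq_atBot_atTop, eventually_sup]
  constructor
  · filter_upwards [eventually_le_atBot d] with q hq
    exact (mul_nonpos_of_nonpos_of_nonneg (by linarith) (H.nonneg q)).trans hr.le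
  · obtain ⟨C, l, hl, hC⟩ := H.exists_le_mul_exp
    have hlim : Tendsto (fun q => (q - d) * (C * Real.exp (-(l * q)))) atTop (𝓝 0) := by
      have e1 : Tendsto (fun q : ℝ => l * q) atTop atTop := tendsto_id.const_mul_atTop hl
      have h1 := (Real.tendsto_pow_mul_exp_neg_atTop_nhds_zero 1).comp e1
      have h2 := (Real.tendsto_pow_mul_exp_neg_atTop_nhds_zero 0).comp e1
      have h3 := (h1.const_mul (C / l)).sub (h2.const_mul (C * d))
      simp only [mul_zero, sub_zero] at h3
      refine h3.congr fun q => ?_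
      simp only [Function.comp, pow_one, pow_zero]
      field_simp
    filter_upwards [hlim.eventually (gt_mem_nhds hr), eventually_ge_atTop d] with q hq hdq
    exact (mul_le_mul_of_nonneg_left (hC q) (by linarith)).trans hq.le

theorem lt_and_pos_of_optimal_price (H : IsMonotoneHazardTail S h) {d p : ℝ} (hd : 0 < S d)
    (hp : ∀ q, (q - d) * S q ≤ (p - d) * S p) : d < p ∧ 0 < S p := by
  obtain ⟨r, hdr, hSr⟩ := H.exists_gt_eq (half_pos hd) (half_lt_self hd)
  have hr : 0 < (r - d) * S r := mul_pos (by linarith) (by rw [hSr]; positivity)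
  have hpp := hr.trans_le (hp r)
  have hSp : 0 < S p := (H.nonneg p).lt_of_ne' (by rintro h0; simp [h0] at hpp)
  exact ⟨by linarith [pos_of_mul_pos_left hpp hSp.le], hSp⟩

/-- At an optimal price for the total cost `d`, trade is at most `e` times less likely than at the
efficient price `d`. -/
theorem mul_exp_neg_one_le_of_optimal_price (H : IsMonotoneHazardTail S h) {d p : ℝ}
    (hp : ∀ q, (q - d) * S q ≤ (p - d) * S p) : S d * Real.exp (-1) ≤ S p := by
  rcases (H.nonneg d).eq_or_lt with h0 | hd
  · rw [← h0, zero_mul]; exact H.nonneg p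
  obtain ⟨hdp, hSp⟩ := H.lt_and_pos_of_optimal_price hd hp
  refine ge_of_tendsto ((H.continuous.tendsto p).mono_left nhdsWithin_le_nhds :
    Tendsto _ (𝓝[<] p) _) ?_
  filter_upwards [Ioo_mem_nhdsLT hdp] with x hx
  have hdx : 0 < x - d := sub_pos.2 hx.1
  have hxp : 0 < p - x := sub_pos.2 hx.2
  -- A first-order condition without derivatives: `x` earns no more than `p`, yet `S x ≥ S p * (1 +
  -- h x * (p - x))`. Together they force `h x ≤ 1 / (x - d)`, so `S` loses at most a factor `e` on
  -- `[d, x]`; then `x` tends to `p`.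
  have h1 := hp x
  have h2 := H.le_sub x p hx.2.le hSp
  have h3 := mul_le_mul_of_nonneg_left h2 hdx.le
  have h4 : (x - d) * h x * (S p * (p - x)) ≤ 1 * (S p * (p - x)) := by linarith
  have h5 : (x - d) * h x ≤ 1 := le_of_mul_le_mul_right h4 (mul_pos hSp hxp)
  have h6 : h x ≤ 1 / (x - d) := by rwa [le_div_iff₀ hdx, mul_comm]
  have := H.mul_exp_le_of_hazard_right_le hx.1.le (hSp.trans_le (H.antitone hx.2.le)) h6
  rwa [one_div, inv_mul_cancel₀ hdx.ne'] at this

/-- Optimal prices can be chosen monotonically in the total cost. -/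
theorem exists_monotone_optimal_price (H : IsMonotoneHazardTail S h) :
    ∃ P : ℝ → ℝ, Monotone P ∧ ∀ d q, (q - d) * S q ≤ (P d - d) * S (P d) := by
  classical
  choose Q hQ using H.exists_optimal_price
  -- Where `S d = 0` the best profit is `0` and the price `d` attains it; fixing this choice keeps
  -- the selection monotone.
  have hopt : ∀ d q, (q - d) * S q ≤
      ((if 0 < S d then Q d else d) - d) * S (if 0 < S d then Q d else d) := by
    intro d q
    split_ifs with hd
    · exact hQ d q
    · rw [sub_self, zero_mul]
      rcases le_total q d with hq | hq
      · exact mul_nonpos_of_nonpos_of_nonneg (by linarith) (H.nonneg q)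
      · rw [le_antisymm ((H.antitone hq).trans (not_lt.1 hd)) (H.nonneg q), mul_zero]
  refine ⟨fun d => if 0 < S d then Q d else d, ?_, hopt⟩
  refine monotone_iff_forall_lt.2 fun d d' hdd' => ?_
  have hd1 := hopt d
  have hd2 := hopt d'
  by_cases hd : 0 < S d
  · obtain ⟨hdp, hSp⟩ := H.lt_and_pos_of_optimal_price hd (hQ d)
    by_cases hd' : 0 < S d'
    · obtain ⟨hdp', hSp'⟩ := H.lt_and_pos_of_optimal_price hd' (hQ d')
      rw [if_pos hd, if_pos hd']
      by_contra! hlt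
      have h1 := hQ d (Q d')
      have h2 := hQ d' (Q d)
      -- Sum of the two optimality conditions. With `Q d' < Q d` it forces equal tails, and then
      -- type `d'` would strictly prefer the higher price `Q d`.
      have h3 : (d' - d) * (S (Q d') - S (Q d)) ≤ 0 := by linarith
      have h4 := H.antitone hlt.le
      have h5 : S (Q d') = S (Q d) :=
        le_antisymm (by nlinarith) h4
      rw [h5] at h2
      have := le_of_mul_le_mul_right h2 hSp
      linarith
    · rw [if_pos hd, if_neg hd']
      by_contra! hlt
      exact hd' (hSp.trans_le (H.antitone hlt.le))
  · rw [if_neg hd, if_neg fun hd' => hd (hd'.trans_le (H.antitone hdd'.le))]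
    exact hdd'.le

end IsMonotoneHazardTail

/-! ### Laws with a monotone hazard rate -/

section Density

variable {ν : Measure ℝ} {f : ℝ → ℝ}

theorem IsDensity.nullSingletonClass (hf : IsDensity ν f) : NullSingletonClass ν := by
  rw [hf.eq_withDensity]; infer_instance

theorem cdf_sub_cdf_eq_measureReal_Ioc [IsProbabilityMeasure ν] {a b : ℝ} (hab : a ≤ b) :
    cdf ν b - cdf ν a = ν.real (Ioc a b) := by
  have h1 : ν (Ioc a b) = ENNReal.ofReal (cdf ν b - cdf ν a) := by
    conv_lhs => rw [← measure_cdf ν]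
    exact (cdf ν).measure_Ioc a b
  rw [measureReal_def, h1, ENNReal.toReal_ofReal (sub_nonneg.2 (monotone_cdf ν hab))]

theorem continuous_cdf [IsProbabilityMeasure ν] [NullSingletonClass ν] : Continuous (cdf ν) := by
  refine continuous_iff_continuousAt.2 fun x => ?_
  have h0 : (cdf ν).measure {x} = 0 := by rw [measure_cdf]; exact measure_singleton x
  rw [StieltjesFunction.measure_singleton, ENNReal.ofReal_eq_zero, sub_nonpos] at h0
  have hl : Function.leftLim (cdf ν) x = cdf ν x :=
    le_antisymm ((monotone_cdf ν).leftLim_le le_rfl) h0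
  refine continuousAt_iff_continuous_left'_right'.2 ⟨?_, ?_⟩
  · exact (monotone_cdf ν).continuousWithinAt_Iio_iff_leftLim_eq.2 hl
  · exact ((cdf ν).right_continuous x).mono Ioi_subset_Ici_self

theorem measure_Ioi_eq_ofReal [IsProbabilityMeasure ν] (x : ℝ) : ν (Ioi x) = ENNReal.ofReal (1 - cdf ν x) := by
  rw [← compl_Iic, prob_compl_eq_one_sub measurableSet_Iic, ← ofReal_cdf ν x,
    ENNReal.ofReal_sub _ (cdf_nonneg ν x), ENNReal.ofReal_one]

theorem measureReal_Ici_eq [IsProbabilityMeasure ν] [NullSingletonClass ν] (x : ℝ) : ν.real (Ici x) = 1 - cdf ν x := by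
  rw [measureReal_def, ← measure_congr Ioi_ae_eq_Ici, measure_Ioi_eq_ofReal,
    ENNReal.toReal_ofReal (sub_nonneg.2 (cdf_le_one ν x))]

theorem IsDensity.le_measureReal_Ioc [IsProbabilityMeasure ν] (hf : IsDensity ν f) {a b m : ℝ}
    (hab : a ≤ b) (hm : ∀ x ∈ Ioc a b, m ≤ f x) : m * (b - a) ≤ ν.real (Ioc a b) := by
  rcases le_total m 0 with h0 | h0
  · exact (mul_nonpos_of_nonpos_of_nonneg h0 (sub_nonneg.2 hab)).trans measureReal_nonneg
  have h1 : ENNReal.ofReal (m * (b - a)) ≤ ν (Ioc a b) := by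
    rw [hf.eq_withDensity, withDensity_apply _ measurableSet_Ioc, ENNReal.ofReal_mul h0,
      ← Real.volume_Ioc, ← setLIntegral_const]
    exact setLIntegral_mono' measurableSet_Ioc fun x hx => ENNReal.ofReal_le_ofReal (hm x hx)
  exact (ENNReal.ofReal_le_iff_le_toReal (measure_ne_top ν _)).1 h1

theorem IsDensity.measureReal_Ioc_le (hf : IsDensity ν f) {a b m : ℝ} (hab : a ≤ b) (h0 : 0 ≤ m)
    (hm : ∀ x ∈ Ioc a b, f x ≤ m) : ν.real (Ioc a b) ≤ m * (b - a) := by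
  have h1 : ν (Ioc a b) ≤ ENNReal.ofReal (m * (b - a)) := by
    rw [hf.eq_withDensity, withDensity_apply _ measurableSet_Ioc, ENNReal.ofReal_mul h0,
      ← Real.volume_Ioc, ← setLIntegral_const]
    exact setLIntegral_mono' measurableSet_Ioc fun x hx => ENNReal.ofReal_le_ofReal (hm x hx)
  exact ENNReal.toReal_le_of_le_ofReal (mul_nonneg h0 (sub_nonneg.2 hab)) h1

/-- On `(a, b]` the density is hazard rate times tail, both monotone, so it lies between `h a * S b`
and `h b * S a`; integrate. -/
theorem IsMHR.isMonotoneHazardTail [IsProbabilityMeasure ν] (hf : IsMHR ν f) :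
    IsMonotoneHazardTail (fun x => 1 - cdf ν x) (hazardRate ν f) := by
  have := hf.density.nullSingletonClass
  have hpos : ∀ {x y : ℝ}, x ≤ y → 0 < 1 - cdf ν y → 0 < 1 - cdf ν x := fun hxy hy =>
    hy.trans_le (sub_le_sub_left (monotone_cdf ν hxy) 1)
  have hmono : ∀ {x y : ℝ}, x ≤ y → 0 < 1 - cdf ν y → hazardRate ν f x ≤ hazardRate ν f y :=
    fun hxy hy => hf.monotone (sub_pos.1 (hpos hxy hy)) (sub_pos.1 hy) hxy
  have hnn : ∀ x, 0 < 1 - cdf ν x → 0 ≤ hazardRate ν f x := fun x hx =>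
    div_nonneg (hf.density.nonneg x) hx.le
  have hfeq : ∀ x, 0 < 1 - cdf ν x → f x = hazardRate ν f x * (1 - cdf ν x) := fun x hx =>
    (div_mul_cancel₀ _ hx.ne').symm
  refine ⟨fun x y hxy => sub_le_sub_left (monotone_cdf ν hxy) 1, continuous_const.sub continuous_cdf,
    fun x => sub_nonneg.2 (cdf_le_one ν x), fun x => sub_le_self _ (cdf_nonneg ν x), ?_, hnn,
    fun x _ y hy hxy => hmono hxy hy, fun a b hab hb => ?_, fun a b hab hb => ?_⟩
  · simpa using (tendsto_cdf_atTop ν).const_sub 1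
  · rw [sub_sub_sub_cancel_left, cdf_sub_cdf_eq_measureReal_Ioc hab]
    refine hf.density.le_measureReal_Ioc hab fun x hx => ?_
    have hx' := hpos hx.2 hb
    rw [hfeq x hx']
    exact mul_le_mul (hmono hx.1.le hx') (sub_le_sub_left (monotone_cdf ν hx.2) 1) hb.le (hnn x hx')
  · rw [sub_sub_sub_cancel_left, cdf_sub_cdf_eq_measureReal_Ioc hab]
    have ha := hpos hab hb
    refine hf.density.measureReal_Ioc_le hab (mul_nonneg (hnn b hb) ha.le) fun x hx => ?_
    have hx' := hpos hx.2 hb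
    rw [hfeq x hx']
    exact mul_le_mul (hmono hx.2 hb) (sub_le_sub_left (monotone_cdf ν hx.1.le) 1) hx'.le (hnn b hb)

end Density

/-! ### The maximum of i.i.d. variables -/

/-- Chebyshev's sum inequality: `b ^ j * a ^ (n - 1 - j)` increases in `j` while `a ^ j` decreases,
and their product is `a ^ (n - 1) * b ^ j`. With `a`, `b` values of the CDF, this yields the lower
increment bound for the maximum. -/
theorem card_mul_sum_pow_le {n : ℕ} {a b : ℝ} (ha : 0 ≤ a) (hab : a ≤ b) (hb : b ≤ 1) :
    n * a ^ (n - 1) * ∑ j ∈ Finset.range n, b ^ j ≤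
      (∑ j ∈ Finset.range n, b ^ j * a ^ (n - 1 - j)) * ∑ j ∈ Finset.range n, a ^ j := by
  have h := AntivaryOn.card_mul_sum_le_sum_mul_sum (s := Finset.range n)
    (f := fun j => b ^ j * a ^ (n - 1 - j)) (g := fun j => a ^ j) (by
      have hm : MonotoneOn (fun j => b ^ j * a ^ (n - 1 - j)) (Finset.range n : Set ℕ) := by
        intro i hi j hj hij
        simp only [Finset.coe_range, mem_Iio] at hi hj
        obtain ⟨m, rfl⟩ := Nat.exists_eq_add_of_le hij
        have e : n - 1 - i = m + (n - 1 - (i + m)) := by omega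
        simp only
        rw [e, pow_add, pow_add, mul_assoc]
        gcongr
        exact pow_nonneg (ha.trans hab) _
      exact hm.antivaryOn fun i _ j _ hij => pow_le_pow_of_le_one ha (hab.trans hb) hij)
  rw [Finset.card_range] at h
  refine le_trans (le_of_eq ?_) h
  rw [mul_assoc, Finset.mul_sum]
  congr 1
  refine Finset.sum_congr rfl fun j hj => ?_
  have hj := Finset.mem_range.1 hj
  rw [mul_assoc, ← pow_add, Nat.sub_add_cancel (by omega), mul_comm]

/-- The companion upper bound: here both sequences decrease in `j`, so Chebyshev's inequality
reverses. -/
theorem sum_pow_mul_sum_le {n : ℕ} {a b : ℝ} (ha : 0 ≤ a) (hab : a ≤ b) (hb : b ≤ 1) :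
    (∑ j ∈ Finset.range n, a ^ j * b ^ (n - 1 - j)) * ∑ j ∈ Finset.range n, b ^ j ≤
      n * b ^ (n - 1) * ∑ j ∈ Finset.range n, a ^ j := by
  have h := MonovaryOn.sum_mul_sum_le_card_mul_sum (s := Finset.range n)
    (f := fun j => a ^ j * b ^ (n - 1 - j)) (g := fun j => b ^ j) (by
      have hm : AntitoneOn (fun j => a ^ j * b ^ (n - 1 - j)) (Finset.range n : Set ℕ) := by
        intro i hi j hj hij
        simp only [Finset.coe_range, mem_Iio] at hi hj
        obtain ⟨m, rfl⟩ := Nat.exists_eq_add_of_le hij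
        have e : n - 1 - i = m + (n - 1 - (i + m)) := by omega
        simp only
        rw [e, pow_add, pow_add, mul_assoc]
        gcongr
        exact pow_nonneg (ha.trans hab) _
      exact hm.monovaryOn fun i _ j _ hij => pow_le_pow_of_le_one (ha.trans hab) hb hij)
  rw [Finset.card_range] at h
  refine h.trans (le_of_eq (Eq.symm ?_))
  rw [mul_assoc, Finset.mul_sum]
  congr 1
  refine Finset.sum_congr rfl fun j hj => ?_
  have hj := Finset.mem_range.1 hj
  rw [mul_assoc, ← pow_add, Nat.sub_add_cancel (by omega), mul_comm]

theorem pow_mul_sum_pow_le {n : ℕ} {a b : ℝ} (ha : 0 ≤ a) (hab : a ≤ b) :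
    a ^ (n - 1) * ∑ j ∈ Finset.range n, b ^ j ≤ b ^ (n - 1) * ∑ j ∈ Finset.range n, a ^ j := by
  rw [Finset.mul_sum, Finset.mul_sum]
  refine Finset.sum_le_sum fun j hj => ?_
  have hj := Finset.mem_range.1 hj
  have hb := ha.trans hab
  have e : n - 1 = (n - 1 - j) + j := by omega
  rw [e, pow_add, pow_add, mul_assoc, mul_assoc, mul_comm (a ^ j) (b ^ j)]
  gcongr

theorem sum_range_pow_pos {n : ℕ} (hn : 1 ≤ n) {a : ℝ} (ha : 0 ≤ a) :
    0 < ∑ j ∈ Finset.range n, a ^ j := by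
  have : a ^ 0 ≤ ∑ j ∈ Finset.range n, a ^ j :=
    Finset.single_le_sum (f := fun j => a ^ j) (fun j _ => pow_nonneg ha j) (Finset.mem_range.2 hn)
  rw [pow_zero] at this
  linarith

theorem one_sub_pow_eq_mul_sum (n : ℕ) (a : ℝ) :
    1 - a ^ n = (1 - a) * ∑ j ∈ Finset.range n, a ^ j := by
  rw [← geom_sum_mul_neg, mul_comm]

theorem pow_sub_pow_eq_mul_sum (n : ℕ) (a b : ℝ) :
    b ^ n - a ^ n = (b - a) * ∑ j ∈ Finset.range n, b ^ j * a ^ (n - 1 - j) := by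
  rw [← (Commute.all b a).geom_sum₂_mul n, mul_comm]

/-- If the tail `S` has a monotone hazard rate, then so has the tail `1 - (1 - S) ^ n` of the
maximum of `n` independent copies. -/
theorem IsMonotoneHazardTail.max {S h : ℝ → ℝ} (H : IsMonotoneHazardTail S h) {n : ℕ} (hn : 1 ≤ n) :
    IsMonotoneHazardTail (fun x => 1 - (1 - S x) ^ n)
      (fun x => h x * (n * (1 - S x) ^ (n - 1) / ∑ j ∈ Finset.range n, (1 - S x) ^ j)) := by
  have hF0 : ∀ x, 0 ≤ 1 - S x := fun x => sub_nonneg.2 (H.le_one x)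
  have hF1 : ∀ x, 1 - S x ≤ 1 := fun x => sub_le_self _ (H.nonneg x)
  have hFm : ∀ {x y}, x ≤ y → 1 - S x ≤ 1 - S y := fun hxy => sub_le_sub_left (H.antitone hxy) 1
  have hs : ∀ x, 0 < ∑ j ∈ Finset.range n, (1 - S x) ^ j := fun x => sum_range_pow_pos hn (hF0 x)
  have hpos : ∀ {x}, 0 < 1 - (1 - S x) ^ n → 0 < S x := by
    intro x hx
    refine (H.nonneg x).lt_of_ne' fun h0 => ?_
    simp [h0] at hx
  -- With `F = 1 - S`, the hazard rate `n F ^ (n - 1) f / (1 - F ^ n)` of the maximum is `h` times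
  -- this factor, after cancelling `1 - F` against `1 - F ^ n`.
  have hq : ∀ x, 0 ≤ n * (1 - S x) ^ (n - 1) / ∑ j ∈ Finset.range n, (1 - S x) ^ j := fun x =>
    div_nonneg (mul_nonneg (Nat.cast_nonneg _) (pow_nonneg (hF0 x) _)) (hs x).le
  refine ⟨?_, ?_, ?_, ?_, ?_, ?_, ?_, ?_, ?_⟩
  · exact fun x y hxy => sub_le_sub_left (pow_le_pow_left₀ (hF0 x) (hFm hxy) n) 1
  · have := H.continuous
    fun_prop
  · exact fun x => sub_nonneg.2 (pow_le_one₀ (hF0 x) (hF1 x))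
  · exact fun x => sub_le_self _ (pow_nonneg (hF0 x) n)
  · simpa using ((H.tendsto_zero.const_sub 1).pow n).const_sub 1
  · exact fun x hx => mul_nonneg (H.hazard_nonneg x (hpos hx)) (hq x)
  · intro x hx y hy hxy
    refine mul_le_mul (H.hazard_mono (hpos hx) (hpos hy) hxy) ?_ (hq x)
      (H.hazard_nonneg y (hpos hy))
    rw [div_le_div_iff₀ (hs x) (hs y), mul_assoc, mul_assoc]
    exact mul_le_mul_of_nonneg_left (pow_mul_sum_pow_le (hF0 x) (hFm hxy)) (Nat.cast_nonneg _)
  · intro a b hab hb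
    have hSb := hpos hb
    have hSa := hSb.trans_le (H.antitone hab)
    have h1 := H.le_sub a b hab hSb
    have h2 := card_mul_sum_pow_le (n := n) (hF0 a) (hFm hab) (hF1 b)
    have h3 : 0 ≤ h a * S b * (b - a) :=
      mul_nonneg (mul_nonneg (H.hazard_nonneg a hSa) hSb.le) (sub_nonneg.2 hab)
    have h4 : 0 ≤ ∑ j ∈ Finset.range n, (1 - S b) ^ j * (1 - S a) ^ (n - 1 - j) :=
      Finset.sum_nonneg fun j _ => mul_nonneg (pow_nonneg (hF0 b) _) (pow_nonneg (hF0 a) _)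
    rw [sub_sub_sub_cancel_left, pow_sub_pow_eq_mul_sum, one_sub_pow_eq_mul_sum, sub_sub_cancel,
      sub_sub_sub_cancel_left]
    calc h a * (n * (1 - S a) ^ (n - 1) / ∑ j ∈ Finset.range n, (1 - S a) ^ j)
          * (S b * ∑ j ∈ Finset.range n, (1 - S b) ^ j) * (b - a)
        = h a * S b * (b - a) * ((n * (1 - S a) ^ (n - 1) * ∑ j ∈ Finset.range n, (1 - S b) ^ j)
            / ∑ j ∈ Finset.range n, (1 - S a) ^ j) := by ring
      _ ≤ h a * S b * (b - a)
            * ∑ j ∈ Finset.range n, (1 - S b) ^ j * (1 - S a) ^ (n - 1 - j) :=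
          mul_le_mul_of_nonneg_left ((div_le_iff₀ (hs a)).2 h2) h3
      _ ≤ _ := mul_le_mul_of_nonneg_right h1 h4
  · intro a b hab hb
    have hSb := hpos hb
    have hSa := hSb.trans_le (H.antitone hab)
    have h1 := H.sub_le a b hab hSb
    have h2 := sum_pow_mul_sum_le (n := n) (hF0 a) (hFm hab) (hF1 b)
    have h3 : 0 ≤ h b * S a * (b - a) :=
      mul_nonneg (mul_nonneg (H.hazard_nonneg b hSb) hSa.le) (sub_nonneg.2 hab)
    have h4 : 0 ≤ ∑ j ∈ Finset.range n, (1 - S a) ^ j * (1 - S b) ^ (n - 1 - j) :=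
      Finset.sum_nonneg fun j _ => mul_nonneg (pow_nonneg (hF0 a) _) (pow_nonneg (hF0 b) _)
    have e : (1 - S b) ^ n - (1 - S a) ^ n
        = (S a - S b) * ∑ j ∈ Finset.range n, (1 - S a) ^ j * (1 - S b) ^ (n - 1 - j) := by
      rw [← neg_sub, pow_sub_pow_eq_mul_sum]; ring
    rw [sub_sub_sub_cancel_left, e, one_sub_pow_eq_mul_sum, sub_sub_cancel]
    calc (S a - S b) * ∑ j ∈ Finset.range n, (1 - S a) ^ j * (1 - S b) ^ (n - 1 - j)
        ≤ h b * S a * (b - a)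
            * ∑ j ∈ Finset.range n, (1 - S a) ^ j * (1 - S b) ^ (n - 1 - j) :=
          mul_le_mul_of_nonneg_right h1 h4
      _ ≤ h b * S a * (b - a) * ((n * (1 - S b) ^ (n - 1) * ∑ j ∈ Finset.range n, (1 - S a) ^ j)
            / ∑ j ∈ Finset.range n, (1 - S b) ^ j) :=
          mul_le_mul_of_nonneg_left ((le_div_iff₀ (hs b)).2 h2) h3
      _ = _ := by ring

/-! ### Monopoly price and expected positive part -/

section Monopoly

variable {ν : Measure ℝ} {f : ℝ → ℝ}

theorem virtualValue_eq_sub_inv_hazardRate (x : ℝ) :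
    virtualValue ν f x = x - 1 / hazardRate ν f x := by
  rw [virtualValue, hazardRate, one_div_div]

theorem pos_of_virtualValue_nonneg {x : ℝ}
    (hx : 0 < f x ∧ cdf ν x < 1 ∧ 0 ≤ virtualValue ν f x) : 0 < x := by
  have h1 : 0 < (1 - cdf ν x) / f x := div_pos (sub_pos.2 hx.2.1) hx.1
  have h2 := hx.2.2
  rw [virtualValue] at h2
  linarith

/-- This and the next lemma read the monopoly price as the point where the hazard rate crosses `1 /
x`. -/
theorem inv_le_hazardRate_of_virtualValue_nonneg {x : ℝ}
    (hx : 0 < f x ∧ cdf ν x < 1 ∧ 0 ≤ virtualValue ν f x) : 1 / x ≤ hazardRate ν f x := by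
  have hh : 0 < hazardRate ν f x := div_pos hx.1 (sub_pos.2 hx.2.1)
  have h2 := hx.2.2
  rw [virtualValue_eq_sub_inv_hazardRate, sub_nonneg] at h2
  rwa [one_div_le (pos_of_virtualValue_nonneg hx) hh]

theorem hazardRate_le_inv_of_not_virtualValue_nonneg {x : ℝ} (h0 : 0 < x) (hc : cdf ν x < 1)
    (hx : ¬ (0 < f x ∧ cdf ν x < 1 ∧ 0 ≤ virtualValue ν f x)) : hazardRate ν f x ≤ 1 / x := by
  by_contra! hlt
  have hh : 0 < hazardRate ν f x := (one_div_pos.2 h0).trans hlt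
  refine hx ⟨?_, hc, ?_⟩
  · have := mul_pos hh (sub_pos.2 hc)
    rwa [hazardRate, div_mul_cancel₀ _ (sub_pos.2 hc).ne'] at this
  · rw [virtualValue_eq_sub_inv_hazardRate, sub_nonneg, one_div_le hh h0]
    exact hlt.le

theorem monopolyPrice_nonneg : 0 ≤ monopolyPrice ν f :=
  Real.sInf_nonneg fun _ hx => (pos_of_virtualValue_nonneg hx).le

theorem lintegral_ofReal_exp_div {r : ℝ} (hr : 0 < r) :
    ∫⁻ t in Ioi 0, ENNReal.ofReal (Real.exp (1 - t / r)) = ENNReal.ofReal (Real.exp 1 * r) := by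
  have hneg : -(1 / r) < 0 := neg_neg_of_pos (one_div_pos.2 hr)
  have e : ∀ t, Real.exp (1 - t / r) = Real.exp 1 * Real.exp (-(1 / r) * t) := by
    intro t
    rw [← Real.exp_add]
    congr 1
    ring
  have hint : IntegrableOn (fun t => Real.exp (1 - t / r)) (Ioi 0) := by
    simp_rw [e]
    exact (integrableOn_exp_mul_Ioi hneg 0).const_mul _
  rw [← ofReal_integral_eq_lintegral_ofReal hint (ae_of_all _ fun t => (Real.exp_pos _).le)]
  simp_rw [e]
  rw [integral_const_mul, integral_exp_mul_Ioi hneg]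
  simp

theorem lintegral_ofReal_eq_lintegral_cdf [IsProbabilityMeasure ν] :
    ∫⁻ x, ENNReal.ofReal x ∂ν = ∫⁻ t in Ioi 0, ENNReal.ofReal (1 - cdf ν t) := by
  have h1 : ∫⁻ x, ENNReal.ofReal x ∂ν = ∫⁻ x, ENNReal.ofReal (max x 0) ∂ν := by simp
  rw [h1, lintegral_eq_lintegral_meas_lt ν (ae_of_all _ fun x => le_max_right x 0)
    (measurable_id.max measurable_const).aemeasurable]
  refine setLIntegral_congr_fun measurableSet_Ioi fun t ht => ?_
  have : {a : ℝ | t < max a 0} = Ioi t := by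
    ext a
    simp [(mem_Ioi.1 ht).not_gt]
  simp only [this, measure_Ioi_eq_ofReal]

/-- For a law with a monotone hazard rate, the expected positive part is at most `e` times the
revenue of the monopoly price. -/
theorem IsMHR.lintegral_ofReal_le [IsProbabilityMeasure ν] (hf : IsMHR ν f) :
    ∫⁻ x, ENNReal.ofReal x ∂ν ≤
      ENNReal.ofReal (Real.exp 1 * (monopolyPrice ν f * (1 - cdf ν (monopolyPrice ν f)))) := by
  have H := hf.isMonotoneHazardTail
  rw [lintegral_ofReal_eq_lintegral_cdf]
  set A := {x | 0 < f x ∧ cdf ν x < 1 ∧ 0 ≤ virtualValue ν f x} with hA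
  have hr : monopolyPrice ν f = sInf A := rfl
  rcases A.eq_empty_or_nonempty with hne | hne
  · have h0 := H.eq_zero_of_hazard_le_inv fun x hx hS =>
      hazardRate_le_inv_of_not_virtualValue_nonneg hx (sub_pos.1 hS)
        fun hxA => (hne ▸ hxA : x ∈ (∅ : Set ℝ))
    refine le_of_eq_of_le ?_ zero_le
    refine setLIntegral_eq_zero measurableSet_Ioi fun t ht => ?_
    exact ENNReal.ofReal_eq_zero.2 (h0 ▸ H.antitone (mem_Ioi.1 ht).le)
  set r := monopolyPrice ν f with hrdef
  have hbdd : BddBelow A := ⟨0, fun x hx => (pos_of_virtualValue_nonneg hx).le⟩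
  have happrox : ∀ x, r < x → ∃ y ∈ A, y < x := fun x hx => exists_lt_of_csInf_lt hne (hr ▸ hx)
  have hmono : ∀ {x y}, y ∈ A → y ≤ x → 0 < 1 - cdf ν x → 1 / y ≤ hazardRate ν f x :=
    fun hy hyx hx => (inv_le_hazardRate_of_virtualValue_nonneg hy).trans
      (hf.monotone hy.2.1 (sub_pos.1 hx) hyx)
  have hSr : 0 < 1 - cdf ν r := by
    obtain ⟨y, hy⟩ := hne
    exact (sub_pos.2 hy.2.1).trans_le (H.antitone (hr ▸ csInf_le hbdd hy))
  -- Were the infimum `0`, points `y` of `A` near `0` would give `1 / y ≤ h x` for a fixed `x`,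
  -- which is absurd.
  have hr0 : 0 < r := by
    refine monopolyPrice_nonneg.lt_of_ne fun h0 => ?_
    obtain ⟨x, hx⟩ := hne
    have hx0 := pos_of_virtualValue_nonneg hx
    have hh : 0 < hazardRate ν f x := div_pos hx.1 (sub_pos.2 hx.2.1)
    obtain ⟨y, hy, hyx⟩ := happrox (min x (1 / hazardRate ν f x))
      (by rw [hrdef, ← h0]; exact lt_min hx0 (one_div_pos.2 hh))
    have h1 := hmono hy (hyx.le.trans (min_le_left _ _)) (sub_pos.2 hx.2.1)
    rw [one_div_le (pos_of_virtualValue_nonneg hy) hh] at h1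
    exact absurd (hyx.trans_le (min_le_right _ _)) h1.not_gt
  -- The infimum need not lie in `A`: take `y ∈ A` decreasing to `r` in `1 / y ≤ h y ≤ h x`.
  have hright : ∀ x, r < x → 0 < 1 - cdf ν x → 1 / r ≤ hazardRate ν f x := by
    intro x hrx hx
    by_contra! hlt
    have hlim : ContinuousAt (fun y : ℝ => 1 / y) r := continuousAt_const.div continuousAt_id hr0.ne'
    obtain ⟨z, hz, hz'⟩ := (((hlim.eventually (lt_mem_nhds hlt)).filter_mono
      nhdsWithin_le_nhds).and (Ioo_mem_nhdsGT hrx)).exists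
    obtain ⟨y, hy, hyz⟩ := happrox z hz'.1
    have h1 := hmono hy (hyz.trans hz'.2).le hx
    have h2 := one_div_le_one_div_of_le (pos_of_virtualValue_nonneg hy) hyz.le
    linarith
  -- Points `y < r` are outside `A`, so `h x ≤ h y ≤ 1 / y`; let `y` increase to `r`.
  have hleft : ∀ x, x < r → hazardRate ν f x ≤ 1 / r := by
    intro x hxr
    have hlim : ContinuousAt (fun y : ℝ => 1 / y) r := continuousAt_const.div continuousAt_id hr0.ne'
    refine ge_of_tendsto (hlim.tendsto.mono_left nhdsWithin_le_nhds : Tendsto _ (𝓝[<] r) _) ?_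
    filter_upwards [Ioo_mem_nhdsLT (max_lt hxr hr0)] with y hy
    have hSy : 0 < 1 - cdf ν y := hSr.trans_le (H.antitone hy.2.le)
    have hxy : x < y := (le_max_left _ _).trans_lt hy.1
    refine (hf.monotone (sub_pos.1 (hSy.trans_le (H.antitone hxy.le))) (sub_pos.1 hSy) hxy.le).trans
      (hazardRate_le_inv_of_not_virtualValue_nonneg ((le_max_right _ _).trans_lt hy.1)
        (sub_pos.1 hSy) fun hyA => ?_)
    exact hy.2.not_ge (hr ▸ csInf_le hbdd hyA)
  have key := H.le_mul_exp_of_subgradient hr0 hSr hright hleft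
  calc ∫⁻ t in Ioi 0, ENNReal.ofReal (1 - cdf ν t)
      ≤ ∫⁻ t in Ioi 0, ENNReal.ofReal (1 - cdf ν r) * ENNReal.ofReal (Real.exp (1 - t / r)) :=
        lintegral_mono fun t => by
          rw [← ENNReal.ofReal_mul hSr.le]
          exact ENNReal.ofReal_le_ofReal (key t)
    _ = ENNReal.ofReal (1 - cdf ν r) * ENNReal.ofReal (Real.exp 1 * r) := by
        rw [lintegral_const_mul' _ _ ENNReal.ofReal_ne_top, lintegral_ofReal_exp_div hr0]
    _ = _ := by
        rw [← ENNReal.ofReal_mul hSr.le]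
        congr 1
        ring

end Monopoly

/-! ### The market -/

section Market

variable {n : ℕ} {F G : Measure ℝ}

instance [IsProbabilityMeasure F] [IsProbabilityMeasure G] :
    IsProbabilityMeasure (jointLaw n F G) := by
  unfold jointLaw; infer_instance

theorem measurable_iSup_sub :
    Measurable fun z : (Fin n → ℝ) × ℝ => (⨆ i, z.1 i) - z.2 :=
  (Measurable.iSup fun i => (measurable_pi_apply i).comp measurable_fst).sub measurable_snd

instance [IsProbabilityMeasure F] [IsProbabilityMeasure G] :
    IsProbabilityMeasure (maxDiffLaw n F G) :=
  Measure.isProbabilityMeasure_map measurable_iSup_sub.aemeasurable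

theorem optSurplus_eq_lintegral :
    optSurplus n F G = ∫⁻ x, ENNReal.ofReal x ∂maxDiffLaw n F G := by
  rw [maxDiffLaw, lintegral_map ENNReal.measurable_ofReal measurable_iSup_sub, optSurplus]

/-- The probability that the maximum of `n` independent values from `F` is at least `x`. -/
def maxTail (n : ℕ) (F : Measure ℝ) (x : ℝ) : ℝ := 1 - (1 - (1 - cdf F x)) ^ n

theorem measurableSet_exists_le (x : ℝ) : MeasurableSet {v : Fin n → ℝ | ∃ i, x ≤ v i} := by
  simp only [ofPred_exists]
  exact MeasurableSet.iUnion fun i => measurableSet_le measurable_const (measurable_pi_apply i)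

theorem measureReal_exists_le [IsProbabilityMeasure F] [NullSingletonClass F] (x : ℝ) :
    (Measure.pi fun _ : Fin n => F).real {v | ∃ i, x ≤ v i} = maxTail n F x := by
  have h1 : {v : Fin n → ℝ | ∃ i, x ≤ v i} = (Set.pi univ fun _ => Iio x)ᶜ := by
    ext v
    simp [Set.mem_pi]
  have h2 : F.real (Iio x) = 1 - (1 - cdf F x) := by
    rw [← measureReal_Ici_eq x, ← compl_Iio, probReal_compl_eq_one_sub measurableSet_Iio]
    ring
  rw [h1, probReal_compl_eq_one_sub (MeasurableSet.univ_pi fun _ => measurableSet_Iio), maxTail,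
    ← h2, measureReal_def, Measure.pi_pi, ENNReal.toReal_prod]
  simp [measureReal_def]

theorem sellerUtility_eq [IsProbabilityMeasure F] [NullSingletonClass F] (w : ℝ → ℝ) (c p : ℝ) :
    sellerUtility n F w c p = (p - w p - c) * maxTail n F p := by
  have hind : ∀ v : Fin n → ℝ, (open Classical in if ∃ i, p ≤ v i then p - w p - c else 0)
      = {v : Fin n → ℝ | ∃ i, p ≤ v i}.indicator (fun _ => p - w p - c) v := fun v => by simp [indicator_apply]
  simp_rw [sellerUtility, hind]
  rw [integral_indicator_const _ (measurableSet_exists_le p), measureReal_exists_le, smul_eq_mul,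
    mul_comm]

theorem measurableSet_exists_comp_le {Q : ℝ → ℝ} (hQ : Measurable Q) :
    MeasurableSet {z : (Fin n → ℝ) × ℝ | ∃ i, Q z.2 ≤ z.1 i} := by
  simp only [ofPred_exists]
  exact MeasurableSet.iUnion fun i => measurableSet_le (hQ.comp measurable_snd)
    ((measurable_pi_apply i).comp measurable_fst)

theorem jointLaw_exists_le [IsProbabilityMeasure F] [IsProbabilityMeasure G]
    [NullSingletonClass F] {Q : ℝ → ℝ} (hQ : Measurable Q) :
    jointLaw n F G {z | ∃ i, Q z.2 ≤ z.1 i} = ∫⁻ c, ENNReal.ofReal (maxTail n F (Q c)) ∂G := by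
  rw [jointLaw, Measure.prod_apply_symm (measurableSet_exists_comp_le hQ)]
  refine lintegral_congr fun c => ?_
  rw [← measureReal_exists_le (Q c), ofReal_measureReal]
  rfl

theorem feeRevenue_eq [IsProbabilityMeasure F] [IsProbabilityMeasure G]
    {w P : ℝ → ℝ} {r : ℝ} (hw : ∀ p, w p = r) (hP : Measurable P) :
    feeRevenue n F G w P = r * (jointLaw n F G).real {z | ∃ i, P z.2 ≤ z.1 i} := by
  have hind : ∀ z : (Fin n → ℝ) × ℝ, (open Classical in if ∃ i, P z.2 ≤ z.1 i then r else 0)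
      = {z : (Fin n → ℝ) × ℝ | ∃ i, P z.2 ≤ z.1 i}.indicator (fun _ => r) z := fun z => by simp [indicator_apply]
  simp_rw [feeRevenue, hw, hind]
  rw [integral_indicator_const _ (measurableSet_exists_comp_le hP), smul_eq_mul, mul_comm]

theorem one_sub_cdf_maxDiffLaw_eq [IsProbabilityMeasure F] [IsProbabilityMeasure G]
    (hn : 1 ≤ n) [NullSingletonClass (maxDiffLaw n F G)] (r : ℝ) :
    1 - cdf (maxDiffLaw n F G) r = (jointLaw n F G).real {z | ∃ i, z.2 + r ≤ z.1 i} := by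
  have : NeZero n := ⟨by omega⟩
  rw [← measureReal_Ici_eq r, maxDiffLaw, map_measureReal_apply measurable_iSup_sub measurableSet_Ici]
  congr 1
  ext z
  simp only [mem_preimage, mem_Ici, mem_ofPred_eq]
  rw [le_sub_iff_add_le']
  constructor
  · intro hz
    obtain ⟨i, hi⟩ := exists_eq_ciSup_of_finite (f := z.1)
    exact ⟨i, hi ▸ hz⟩
  · rintro ⟨i, hi⟩
    exact hi.trans (le_ciSup (finite_range z.1).bddAbove i)

/-- Against any equilibrium strategy under a constant fee `r`, trade is at most `e` times less
likely than if the seller named the price `c + r`. -/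
theorem IsSellerBNE.mul_exp_neg_one_le [IsProbabilityMeasure F] [IsProbabilityMeasure G]
    [NullSingletonClass F] {h w P : ℝ → ℝ}
    (H : IsMonotoneHazardTail (maxTail n F) h) {r : ℝ} (hw : ∀ p, w p = r)
    (hP : IsSellerBNE n F G w P) :
    (jointLaw n F G).real {z | ∃ i, z.2 + r ≤ z.1 i} * Real.exp (-1) ≤
      (jointLaw n F G).real {z | ∃ i, P z.2 ≤ z.1 i} := by
  have key : jointLaw n F G {z | ∃ i, z.2 + r ≤ z.1 i} * ENNReal.ofReal (Real.exp (-1)) ≤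
      jointLaw n F G {z | ∃ i, P z.2 ≤ z.1 i} := by
    rw [jointLaw_exists_le (Q := fun c => c + r) (measurable_id.add_const r),
      jointLaw_exists_le hP.measurable, ← lintegral_mul_const' _ _ ENNReal.ofReal_ne_top]
    refine lintegral_mono_ae ?_
    -- Best response is known only on the support of `G`, which has full measure; there the seller
    -- solves the monopoly problem with total cost `c + r`.
    filter_upwards [Measure.support_mem_ae (μ := G)] with c hc
    rw [← ENNReal.ofReal_mul (H.nonneg _)]
    refine ENNReal.ofReal_le_ofReal (H.mul_exp_neg_one_le_of_optimal_price fun q => ?_)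
    have := hP.best_response c hc q
    rw [sellerUtility_eq, sellerUtility_eq, hw, hw] at this
    convert this using 2 <;> ring
  have := ENNReal.toReal_mono (measure_ne_top _ _) key
  rwa [ENNReal.toReal_mul, ENNReal.toReal_ofReal (Real.exp_pos _).le] at this

theorem exists_isSellerBNE [IsProbabilityMeasure F] [NullSingletonClass F] {h w : ℝ → ℝ}
    (H : IsMonotoneHazardTail (maxTail n F) h) {r : ℝ} (hw : ∀ p, w p = r) :
    ∃ P, IsSellerBNE n F G w P := by
  -- Monotonicity of the selection supplies the measurability of the strategy.
  obtain ⟨Q, hQm, hQ⟩ := H.exists_monotone_optimal_price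
  refine ⟨fun c => Q (c + r), hQm.measurable.comp (measurable_id.add_const r), fun c _ p => ?_⟩
  rw [sellerUtility_eq, sellerUtility_eq, hw, hw]
  convert hQ (c + r) p using 2 <;> ring

end Market

/-! ### The optimal revenue is at most the optimal surplus -/

/-- Interim utilities overwrite coordinate `i` by a report; drawing that report from `F` recovers
the ex-ante expectation. It suffices to test boxes, whose preimages are boxes with side `i` moved to
the fresh coordinate. -/
theorem measurePreserving_update {n : ℕ} (F : Measure ℝ) [IsProbabilityMeasure F] (i : Fin n) :
    MeasurePreserving (fun p : (Fin n → ℝ) × ℝ => Function.update p.1 i p.2)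
      ((Measure.pi fun _ : Fin n => F).prod F) (Measure.pi fun _ : Fin n => F) := by
  have hm : Measurable fun p : (Fin n → ℝ) × ℝ => Function.update p.1 i p.2 := by
    refine measurable_pi_iff.2 fun j => ?_
    rcases eq_or_ne j i with rfl | hj
    · simpa using measurable_snd
    · simpa [hj, Function.comp_def] using (measurable_pi_apply j).comp measurable_fst
  refine ⟨hm, (Measure.pi_eq fun s hs => ?_).symm⟩
  have hpre : (fun p : (Fin n → ℝ) × ℝ => Function.update p.1 i p.2) ⁻¹' Set.pi univ s
      = Set.pi univ (Function.update s i univ) ×ˢ s i := by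
    ext ⟨v, r⟩
    simp only [mem_preimage, Set.mem_pi, mem_univ, true_implies, mem_prod]
    constructor
    · refine fun h => ⟨fun j => ?_, by simpa using h i⟩
      rcases eq_or_ne j i with rfl | hj
      · simp
      · simpa [hj] using h j
    · rintro ⟨h, hr⟩ j
      rcases eq_or_ne j i with rfl | hj
      · simpa using hr
      · simpa [hj] using h j
  rw [Measure.map_apply hm (MeasurableSet.univ_pi hs), hpre, Measure.prod_prod, Measure.pi_pi,
    ← Finset.mul_prod_erase _ _ (Finset.mem_univ i),
    ← Finset.mul_prod_erase _ (fun j => F (s j)) (Finset.mem_univ i)]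
  simp only [Function.update_self, measure_univ, one_mul]
  rw [mul_comm]
  congr 1
  refine Finset.prod_congr rfl fun j hj => ?_
  rw [Function.update_of_ne (Finset.ne_of_mem_erase hj)]

/-- Resampling the value of one buyer preserves the joint law. -/
theorem measurePreserving_update_jointLaw {n : ℕ} (F G : Measure ℝ) [IsProbabilityMeasure F]
    [IsProbabilityMeasure G] (i : Fin n) :
    MeasurePreserving
      (fun p : ((Fin n → ℝ) × ℝ) × ℝ => ((Function.update p.1.1 i p.2, p.1.2) : (Fin n → ℝ) × ℝ))
      ((jointLaw n F G).prod F) (jointLaw n F G) := by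
  have h1 := measurePreserving_prodAssoc (Measure.pi fun _ : Fin n => F) G F
  have h2 := (MeasurePreserving.id (Measure.pi fun _ : Fin n => F)).prod
    (Measure.measurePreserving_swap (μ := G) (ν := F))
  have h3 := (measurePreserving_prodAssoc (Measure.pi fun _ : Fin n => F) F G).symm
  have h4 := (measurePreserving_update F i).prod (MeasurePreserving.id G)
  exact h4.comp (h3.comp (h2.comp h1))

theorem ae_nonneg_of_measure_Iio_eq_zero {F : Measure ℝ} (hF : F (Iio 0) = 0) :
    ∀ᵐ x ∂F, 0 ≤ x := by
  have h : ∀ᵐ x ∂F, x ∉ Iio 0 := measure_eq_zero_iff_ae_notMem.1 hF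
  simpa using h

/-- The bound by `e` times monopoly revenue, applied to `F` itself, shows that its mean is finite.
-/
theorem IsMHR.integrable_id {F : Measure ℝ} [IsProbabilityMeasure F] {f : ℝ → ℝ} (hF : IsMHR F f)
    (hF0 : F (Iio 0) = 0) : Integrable (fun x : ℝ => x) F := by
  have h0 := ae_nonneg_of_measure_Iio_eq_zero hF0
  refine ⟨measurable_id.aestronglyMeasurable, ?_⟩
  rw [hasFiniteIntegral_iff_ofReal h0]
  exact hF.lintegral_ofReal_le.trans_lt ENNReal.ofReal_lt_top

theorem ofReal_integral_le_lintegral_ofReal {α : Type*} [MeasurableSpace α] {μ : Measure α}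
    {g : α → ℝ} (hg : Integrable g μ) :
    ENNReal.ofReal (∫ a, g a ∂μ) ≤ ∫⁻ a, ENNReal.ofReal (g a) ∂μ := by
  rw [integral_eq_lintegral_pos_part_sub_lintegral_neg_part hg]
  exact (ENNReal.ofReal_le_ofReal (sub_le_self _ ENNReal.toReal_nonneg)).trans
    ENNReal.ofReal_toReal_le

namespace DirectMechanism

variable {n : ℕ} (M : DirectMechanism n) {F G : Measure ℝ}

theorem alloc_le_one (i : Fin n) (v : Fin n → ℝ) (c : ℝ) : M.alloc i v c ≤ 1 :=
  (Finset.single_le_sum (f := fun j => M.alloc j v c) (fun j _ => M.alloc_nonneg j v c)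
    (Finset.mem_univ i)).trans (M.sum_alloc_le_one v c)

theorem sum_alloc_nonneg (v : Fin n → ℝ) (c : ℝ) : 0 ≤ ∑ i, M.alloc i v c :=
  Finset.sum_nonneg fun i _ => M.alloc_nonneg i v c

theorem measurable_sum_alloc :
    Measurable fun z : (Fin n → ℝ) × ℝ => ∑ i, M.alloc i z.1 z.2 :=
  Finset.measurable_sum _ fun i _ => M.measurable_alloc i

theorem integrable_value_mul_alloc [IsProbabilityMeasure F] [IsProbabilityMeasure G]
    (hF : Integrable (fun x : ℝ => x) F) (i : Fin n) :
    Integrable (fun z => z.1 i * M.alloc i z.1 z.2) (jointLaw n F G) := by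
  have h1 : Integrable (fun z : (Fin n → ℝ) × ℝ => z.1 i) (jointLaw n F G) :=
    ((measurePreserving_eval (fun _ : Fin n => F) i).comp
      (measurePreserving_fst (μ := Measure.pi fun _ : Fin n => F) (ν := G))
      ).integrable_comp_of_integrable hF
  refine h1.mul_bdd (c := 1) (M.measurable_alloc i).aestronglyMeasurable (ae_of_all _ fun z => ?_)
  rw [Real.norm_of_nonneg (M.alloc_nonneg i _ _)]
  exact M.alloc_le_one i _ _

/-- By resampling, the ex-ante utility of buyer `i` is the average over `r` of the interim
utilities, which are non-negative on the support of `F`. -/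
theorem integral_buyerPay_le [IsProbabilityMeasure F] [IsProbabilityMeasure G]
    (hM : M.FinitePayments F G) (hIR : M.IsInterimIR F G)
    (hF : Integrable (fun x : ℝ => x) F) (i : Fin n) :
    ∫ z, M.buyerPay i z.1 z.2 ∂jointLaw n F G ≤
      ∫ z, z.1 i * M.alloc i z.1 z.2 ∂jointLaw n F G := by
  have hval := M.integrable_value_mul_alloc (G := G) hF i
  have hU : Integrable (fun z => z.1 i * M.alloc i z.1 z.2 - M.buyerPay i z.1 z.2)
    (jointLaw n F G) := hval.sub (hM.buyer i)
  have hmp := measurePreserving_update_jointLaw (n := n) F G i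
  rw [← sub_nonneg, ← integral_sub hval (hM.buyer i), ← hmp.map_eq,
    integral_map hmp.measurable.aemeasurable (by rw [hmp.map_eq]; exact hU.aestronglyMeasurable),
    integral_prod_symm (fun p : ((Fin n → ℝ) × ℝ) × ℝ =>
      (Function.update p.1.1 i p.2) i * M.alloc i (Function.update p.1.1 i p.2) p.1.2
        - M.buyerPay i (Function.update p.1.1 i p.2) p.1.2) (hmp.integrable_comp_of_integrable hU)]
  refine integral_nonneg_of_ae ?_
  filter_upwards [Measure.support_mem_ae (μ := F)] with r hr
  have := hIR.buyer i r hr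
  simpa [buyerUtility] using this

theorem integrable_sum_alloc_interim [IsProbabilityMeasure F] (c : ℝ) :
    Integrable (fun v => ∑ i, M.alloc i v c) (Measure.pi fun _ : Fin n => F) := by
  refine Integrable.of_bound (C := 1)
    (M.measurable_sum_alloc.comp measurable_prodMk_right).aestronglyMeasurable
    (ae_of_all _ fun v => ?_)
  simpa [Real.norm_of_nonneg (M.sum_alloc_nonneg v c)] using M.sum_alloc_le_one v c

/-- The cost is not assumed to have a finite mean; interim rationality dominates the expected cost
of trading by the seller's integrable interim payment. -/
theorem integrable_cost_mul_alloc [IsProbabilityMeasure F] [IsProbabilityMeasure G]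
    (hM : M.FinitePayments F G) (hIR : M.IsInterimIR F G) (hG : ∀ᵐ c ∂G, 0 ≤ c) :
    Integrable (fun z => z.2 * ∑ i, M.alloc i z.1 z.2) (jointLaw n F G) := by
  have hmeas : StronglyMeasurable fun z : (Fin n → ℝ) × ℝ => z.2 * ∑ i, M.alloc i z.1 z.2 :=
    (measurable_snd.mul M.measurable_sum_alloc).stronglyMeasurable
  refine (integrable_prod_iff' hmeas.aestronglyMeasurable).2
    ⟨ae_of_all _ fun c => (M.integrable_sum_alloc_interim c).const_mul c, ?_⟩
  refine Integrable.mono' (g := fun c => ∫ v, M.sellerPay v c ∂(Measure.pi fun _ : Fin n => F))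
    hM.seller.integral_prod_right hmeas.norm.integral_prod_left'.aestronglyMeasurable ?_
  filter_upwards [Measure.support_mem_ae (μ := G), hG] with c hc hc0
  have h1 := hIR.seller c hc
  rw [sellerUtility, integral_sub (hM.seller_interim c hc)
    ((M.integrable_sum_alloc_interim c).const_mul c), sub_nonneg] at h1
  rw [Real.norm_of_nonneg (integral_nonneg fun v => norm_nonneg _)]
  refine le_trans (le_of_eq (integral_congr_ae (ae_of_all _ fun v => ?_))) h1
  exact Real.norm_of_nonneg (mul_nonneg hc0 (M.sum_alloc_nonneg v c))

theorem integral_cost_le_integral_sellerPay [IsProbabilityMeasure F] [IsProbabilityMeasure G]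
    (hM : M.FinitePayments F G) (hIR : M.IsInterimIR F G) (hG : ∀ᵐ c ∂G, 0 ≤ c) :
    ∫ z, z.2 * ∑ i, M.alloc i z.1 z.2 ∂jointLaw n F G ≤
      ∫ z, M.sellerPay z.1 z.2 ∂jointLaw n F G := by
  have hcost := M.integrable_cost_mul_alloc hM hIR hG
  rw [← sub_nonneg, ← integral_sub hM.seller hcost, jointLaw,
    integral_prod_symm (fun z => M.sellerPay z.1 z.2 - z.2 * ∑ i, M.alloc i z.1 z.2)
      (hM.seller.sub hcost)]
  refine integral_nonneg_of_ae ?_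
  filter_upwards [Measure.support_mem_ae (μ := G)] with c hc using hIR.seller c hc

/-- The gains from trade of any allocation are at most those of the efficient allocation. -/
theorem sum_mul_alloc_sub_le (v : Fin n → ℝ) (c : ℝ) :
    ∑ i, v i * M.alloc i v c - c * ∑ i, M.alloc i v c ≤ max ((⨆ i, v i) - c) 0 := by
  calc ∑ i, v i * M.alloc i v c - c * ∑ i, M.alloc i v c
      = ∑ i, (v i - c) * M.alloc i v c := by
        rw [Finset.mul_sum, ← Finset.sum_sub_distrib]
        exact Finset.sum_congr rfl fun i _ => (sub_mul _ _ _).symm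
    _ ≤ ∑ i, max ((⨆ i, v i) - c) 0 * M.alloc i v c := by
        refine Finset.sum_le_sum fun i _ => mul_le_mul_of_nonneg_right ?_ (M.alloc_nonneg i v c)
        exact le_max_of_le_left (sub_le_sub_right (le_ciSup (finite_range v).bddAbove i) c)
    _ ≤ _ := by
        rw [← Finset.mul_sum]
        exact mul_le_of_le_one_right (le_max_right _ _) (M.sum_alloc_le_one v c)

theorem ofReal_revenue_le_optSurplus [IsProbabilityMeasure F] [IsProbabilityMeasure G]
    (hM : M.FinitePayments F G) (hIR : M.IsInterimIR F G)
    (hF : Integrable (fun x : ℝ => x) F) (hG : ∀ᵐ c ∂G, 0 ≤ c) :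
    ENNReal.ofReal (M.revenue F G) ≤ optSurplus n F G := by
  have hval := fun i => M.integrable_value_mul_alloc (G := G) hF i
  have hcost := M.integrable_cost_mul_alloc hM hIR hG
  have hsum : Integrable (fun z => ∑ i, z.1 i * M.alloc i z.1 z.2) (jointLaw n F G) :=
    integrable_finsetSum _ fun i _ => hval i
  have hrev : M.revenue F G ≤
      ∫ z, (∑ i, z.1 i * M.alloc i z.1 z.2 - z.2 * ∑ i, M.alloc i z.1 z.2) ∂jointLaw n F G := by
    rw [revenue, integral_sub (integrable_finsetSum _ fun i _ => hM.buyer i) hM.seller,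
      integral_sub hsum hcost, integral_finsetSum _ fun i _ => hM.buyer i,
      integral_finsetSum _ fun i _ => hval i]
    exact sub_le_sub (Finset.sum_le_sum fun i _ => M.integral_buyerPay_le hM hIR hF i)
      (M.integral_cost_le_integral_sellerPay hM hIR hG)
  refine (ENNReal.ofReal_le_ofReal hrev).trans
    ((ofReal_integral_le_lintegral_ofReal (hsum.sub hcost)).trans (lintegral_mono fun z => ?_))
  refine (ENNReal.ofReal_le_ofReal (M.sum_mul_alloc_sub_le z.1 z.2)).trans (le_of_eq ?_)
  simp

end DirectMechanism

theorem optRevenue_le_optSurplus {n : ℕ} {F G : Measure ℝ} [IsProbabilityMeasure F]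
    [IsProbabilityMeasure G] (hF : Integrable (fun x : ℝ => x) F) (hG : ∀ᵐ c ∂G, 0 ≤ c) :
    optRevenue n F G ≤ optSurplus n F G :=
  iSup_le fun M => iSup_le fun hM => iSup_le fun _ => iSup_le fun hIR =>
    M.ofReal_revenue_le_optSurplus hM hIR hF hG

end Exchange

end

theorem mainTheorem8 (n : ℕ) (hn : 1 ≤ n)
    (F G : Measure ℝ) [IsProbabilityMeasure F] [IsProbabilityMeasure G]
    (hF_nonneg : F (Set.Iio 0) = 0) (hG_nonneg : G (Set.Iio 0) = 0)
    (f k : ℝ → ℝ)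
    (hF : Exchange.IsMHR F f)
    (hk : Exchange.IsMHR (Exchange.maxDiffLaw n F G) k)
    (w : ℝ → ℝ) (hw : ∀ p, w p = Exchange.monopolyPrice (Exchange.maxDiffLaw n F G) k) :
    (∃ P, Exchange.IsSellerBNE n F G w P) ∧
    ∀ P, Exchange.IsSellerBNE n F G w P →
      Exchange.optSurplus n F G ≤
          ENNReal.ofReal (Real.exp 2 * Exchange.feeRevenue n F G w P) ∧
        Exchange.optRevenue n F G ≤
          ENNReal.ofReal (Real.exp 2 * Exchange.feeRevenue n F G w P) := by
  have := hF.density.nullSingletonClass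
  have := hk.density.nullSingletonClass
  have H := hF.isMonotoneHazardTail.max hn
  refine ⟨Exchange.exists_isSellerBNE H hw, fun P hP => ?_⟩
  have hsurplus : Exchange.optSurplus n F G ≤
      ENNReal.ofReal (Real.exp 2 * Exchange.feeRevenue n F G w P) := by
    rw [Exchange.optSurplus_eq_lintegral]
    refine hk.lintegral_ofReal_le.trans (ENNReal.ofReal_le_ofReal ?_)
    rw [Exchange.one_sub_cdf_maxDiffLaw_eq hn, Exchange.feeRevenue_eq hw hP.measurable]
    -- The second factor `e`: both sides are now the fee times a probability of trade, at the prices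
    -- `c + r` and `P c`.
    have h1 := hP.mul_exp_neg_one_le H hw
    rw [Real.exp_neg, ← div_eq_mul_inv, div_le_iff₀ (Real.exp_pos 1)] at h1
    have h2 := mul_le_mul_of_nonneg_left (mul_le_mul_of_nonneg_left h1
      (Exchange.monopolyPrice_nonneg (ν := Exchange.maxDiffLaw n F G) (f := k)))
      (Real.exp_pos 1).le
    refine h2.trans (le_of_eq ?_)
    rw [show (2 : ℝ) = 1 + 1 by norm_num, Real.exp_add]
    ring
  refine ⟨hsurplus, le_trans ?_ hsurplus⟩
  exact Exchange.optRevenue_le_optSurplus (hF.integrable_id hF_nonneg)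
    (Exchange.ae_nonneg_of_measure_Iio_eq_zero hG_nonneg)
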